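/- Let $n_1,n_2\ge 1$ and $n=n_1n_2$. For $s\ge 1$ let $\mathcal C$ be the class of $s$-submatrices of an $n_1\times n_2$ matrix, i.e. of all sets $S_1\times S_2$ with $S_1\subseteq\{1,\dots,n_1\}$, $S_2\subseteq\{1,\dots,n_2\}$ and $|S_1|\cdot|S_2|=s$. Suppose that $s<n$ and that $\{1,\dots,n_1\}\times\{1,\dots,n_2\}$ is a union of pairwise disjoint $s$-submatrices. Fix $\mu>0$, $m>0$ and $\varepsilon\in(0,1)$. For $S\subseteq\{1,\dots,n_1\}\times\{1,\dots,n_2\}$ let the signal $x$ be equal to $\mu$ on $S$ and to $0$ off $S$. An adaptive sensing strategy chooses successively, for $j=1,2,\dots$, an entry $A_j$ and a precision $\Gamma_j\ge 0$, by a possibly randomized rule that uses only the past $(A_i,\Gamma_i,Y_i)_{i<j}$ and does not depend on $S$, and then observes $Y_j=x_{A_j}+\Gamma_j^{-1/2}W_j$, where $W_j\sim\mathcal N(0,1)$ is independent of the past and of $(A_j,\Gamma_j)$ (if $\Gamma_j=0$, nothing is observed). Let $\mathbb P_S$ be the resulting law of $(A_j,\Gamma_j,Y_j)_{j\ge1}$,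 with expectation $\mathbb E_S$, and let $\hat S$ be an estimator of $S$, i.e. a measurable function of $(A_j,\Gamma_j,Y_j)_{j\ge1}$ with values in the subsets of $\{1,\dots,n_1\}\times\{1,\dots,n_2\}$. Assume the budget constraint $\mathbb E_S\big(\sum_j\Gamma_j\big)\le m$ for all $S\in\mathcal C\cup\{\emptyset\}$. (i) If $\max_{S\in\mathcal C\cup\{\emptyset\}}\mathbb P_S(\hat S\ne S)\le\varepsilon$, then necessarily $$\mu\ \ge\ \sqrt{\frac{2n}{sm}\log\frac1{2\varepsilon}}.$$ (ii) If $\max_{S\in\mathcal C\cup\{\emptyset\}}\mathbb E_S\big(|\hat S\,\triangle\,S|\big)\le\varepsilon$, then necessarily $$\mu\ \ge\ \sqrt{\frac{2(n-s)}{sm}\left(\log\frac{n-s}{n+s}+\log\frac{s}{8\varepsilon}\right)}.$$ (The square root of a negative number is read as $0$, so that the bound is then void.) -/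

import Mathlib

open MeasureTheory ProbabilityTheory
open scoped NNReal ENNReal

namespace AdaptiveSensing

/-- The entries of an `n₁ × n₂` matrix. -/
abbrev Entry (n₁ n₂ : ℕ) : Type := Fin n₁ × Fin n₂

/-- A sensing action `(A, Γ)`: the entry `A` to be measured and the precision `Γ`.
The value `Γ = 0` means that no measurement is taken (so a procedure may stop). -/
abbrev Action (n₁ n₂ : ℕ) : Type := Entry n₁ n₂ × ℝ≥0

/-- The record `((A, Γ), Y)` of one step: the action together with the value observed. -/
abbrev Record (n₁ n₂ : ℕ) : Type := Action n₁ n₂ × ℝ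

/-- The sequence of all records `(Aⱼ, Γⱼ, Yⱼ)`, `j = 0, 1, 2, …`. -/
abbrev Data (n₁ n₂ : ℕ) : Type := ℕ → Record n₁ n₂

/-- The signal with support `S` and magnitude `μ`: `μ` on `S` and `0` off `S`. -/
noncomputable def signal {n₁ n₂ : ℕ} (μ : ℝ) (S : Finset (Entry n₁ n₂)) (i : Entry n₁ n₂) : ℝ :=
  if i ∈ S then μ else 0

/-- The record produced by the action `(A, Γ)` and the noise `W`: the observed value is
`x_A + Γ^(-1/2) W`. If `Γ = 0` nothing is measured, and the observed value is the
uninformative constant `0`. -/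
noncomputable def observe {n₁ n₂ : ℕ} (x : Entry n₁ n₂ → ℝ) (p : Action n₁ n₂ × ℝ) :
    Record n₁ n₂ :=
  (p.1, if p.1.2 = 0 then 0 else x p.1.1 + (Real.sqrt p.1.2)⁻¹ * p.2)

lemma measurable_observe {n₁ n₂ : ℕ} (x : Entry n₁ n₂ → ℝ) : Measurable (observe x) := by
  have hx : Measurable x := measurable_of_finite x
  refine Measurable.prodMk measurable_fst (Measurable.ite ?_ measurable_const ?_)
  · exact measurableSet_eq_fun (by fun_prop) measurable_const
  · fun_prop

/-- Given the action, the law of the record when the noise `W ∼ 𝒩(0, 1)` is drawn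
independently of the action (and of everything before). -/
noncomputable def observeKernel {n₁ n₂ : ℕ} (x : Entry n₁ n₂ → ℝ) :
    Kernel (Action n₁ n₂) (Record n₁ n₂) :=
  (Kernel.id ×ₖ Kernel.const (Action n₁ n₂) (gaussianReal 0 1)).map (observe x)

instance {n₁ n₂ : ℕ} (x : Entry n₁ n₂ → ℝ) : IsMarkovKernel (observeKernel x) :=
  Kernel.IsMarkovKernel.map _ (measurable_observe x)

/-- An adaptive sensing strategy: the law of the first action, and the conditional law of each
later action given all the records so far. The choices may be randomized (Dirac kernels give the
deterministic strategies); they do not depend on the unknown support. -/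
structure Strategy (n₁ n₂ : ℕ) where
  /-- law of the action taken at time `0` -/
  first : Measure (Action n₁ n₂)
  /-- conditional law of the action taken at time `j + 1` given the records `0, …, j` -/
  next : (j : ℕ) → Kernel (Finset.Iic j → Record n₁ n₂) (Action n₁ n₂)
  isProbabilityMeasure_first : IsProbabilityMeasure first
  isMarkovKernel_next : ∀ j, IsMarkovKernel (next j)

attribute [instance] Strategy.isProbabilityMeasure_first Strategy.isMarkovKernel_next

/-- The joint law of all the records `(Aⱼ, Γⱼ, Yⱼ)` when the strategy is applied to the
signal `x`. -/
noncomputable def Strategy.dataLaw {n₁ n₂ : ℕ} (σ : Strategy n₁ n₂) (x : Entry n₁ n₂ → ℝ) :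
    Measure (Data n₁ n₂) :=
  Kernel.trajMeasure (X := fun _ : ℕ => Record n₁ n₂) (observeKernel x ∘ₘ σ.first)
    (fun j => observeKernel x ∘ₖ σ.next j)

instance {n₁ n₂ : ℕ} (σ : Strategy n₁ n₂) (x : Entry n₁ n₂ → ℝ) :
    IsProbabilityMeasure (σ.dataLaw x) := by
  unfold Strategy.dataLaw
  infer_instance

/-- The total precision `∑ⱼ Γⱼ` that was used. -/
noncomputable def totalPrecision {n₁ n₂ : ℕ} (h : Data n₁ n₂) : ℝ≥0∞ :=
  ∑' j, ((h j).1.2 : ℝ≥0∞)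

/-- The class of `s`-submatrices: products `S₁ × S₂` with `|S₁| · |S₂| = s`. -/
def submatrices (n₁ n₂ s : ℕ) : Set (Finset (Entry n₁ n₂)) :=
  {S | ∃ (S₁ : Finset (Fin n₁)) (S₂ : Finset (Fin n₂)), S₁.card * S₂.card = s ∧ S = S₁ ×ˢ S₂}

/-- The whole matrix is a union of pairwise disjoint `s`-submatrices. -/
def TiledBySubmatrices (n₁ n₂ s : ℕ) : Prop :=
  ∃ D : Set (Finset (Entry n₁ n₂)), D ⊆ submatrices n₁ n₂ s ∧ D.PairwiseDisjoint id ∧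
    ∀ i : Entry n₁ n₂, ∃ S ∈ D, i ∈ S

end AdaptiveSensing

namespace AdaptiveSensing

/-! The budget is spent under the empty support and must be shared among `N = n / s` disjoint tiles.
An action with precision `Γ` separates the null signal from the signal of `S` by relative entropy
`μ² Γ / 2` if its entry lies in `S`, and by nothing otherwise. Since an entry lies in at most one
tile, the expected informations, computed under the null, sum to at most `μ² m / 2`
(`sum_totalInfo_le`).

On the other hand each tile needs a definite amount of information. Let `A S` be events, one for
each tile, whose null probabilities sum to at most `δ`, while each `A S` fails under `S` with
probability at most `δ`. The change of measure `exp_sub_totalInfo_le`, applied to the complement of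
`A S`, bounds the information of `S` from below. Averaging over the tiles gives `N log (1 / (2δ)) ≤
μ² m / 2`, which is `card_mul_log_le`.

Exact recovery takes for `A S` the event that the estimator equals `S`, with `δ = ε`; Hamming loss
takes the event that the estimator covers at least half of `S`, with `δ = 2ε / s`.

The change of measure rests on the chain rule `EntropyLE.compProd`: choosing an action costs
nothing, because the rule ignores the support, and only observations contribute. The bounds on
finite horizons are uniform, so they pass to the infinite trajectory. -/

/-- The relative entropy of `P` with respect to `Q` is at most `κ`, in the variational form of
Donsker and Varadhan. -/
def EntropyLE {α : Type*} [MeasurableSpace α] (P Q : Measure α) (κ : ℝ) : Prop :=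
  ∀ f : α → ℝ, Measurable f → (∃ C, ∀ x, |f x| ≤ C) →
    Real.exp (∫ x, f x ∂P - κ) ≤ ∫ x, Real.exp (f x) ∂Q

/-! ### Relative entropy: data processing, chain rule, Gaussian shifts, infinite horizon -/

section Entropy

variable {α β : Type*} [MeasurableSpace α] [MeasurableSpace β]

lemma integrable_of_abs_le {P : Measure α} [IsFiniteMeasure P] {f : α → ℝ} (hf : Measurable f)
    {C : ℝ} (hC : ∀ x, |f x| ≤ C) : Integrable f P :=
  Integrable.of_bound hf.aestronglyMeasurable C (Filter.Eventually.of_forall hC)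

lemma abs_exp_le_of_abs_le {t C : ℝ} (h : |t| ≤ C) : |Real.exp t| ≤ Real.exp C := by
  rw [abs_of_pos (Real.exp_pos _)]
  exact Real.exp_le_exp.2 ((le_abs_self _).trans h)

lemma integrable_exp_of_abs_le {P : Measure α} [IsFiniteMeasure P] {f : α → ℝ}
    (hf : Measurable f) {C : ℝ} (hC : ∀ x, |f x| ≤ C) :
    Integrable (fun x => Real.exp (f x)) P :=
  integrable_of_abs_le hf.exp fun x => abs_exp_le_of_abs_le (hC x)

lemma exp_integral_le_integral_exp {P : Measure α} [IsProbabilityMeasure P] {f : α → ℝ}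
    (hf : Integrable f P) (hexp : Integrable (fun x => Real.exp (f x)) P) :
    Real.exp (∫ x, f x ∂P) ≤ ∫ x, Real.exp (f x) ∂P :=
  convexOn_exp.map_integral_le Real.continuous_exp.continuousOn isClosed_univ
    (Filter.Eventually.of_forall fun _ => Set.mem_univ _) hf hexp

lemma EntropyLE.refl (P : Measure α) [IsProbabilityMeasure P] : EntropyLE P P 0 := by
  rintro f hf ⟨C, hC⟩
  rw [sub_zero]
  exact exp_integral_le_integral_exp (integrable_of_abs_le hf hC) (integrable_exp_of_abs_le hf hC)

lemma EntropyLE.mono {P Q : Measure α} {κ κ' : ℝ} (h : EntropyLE P Q κ) (hκ : κ ≤ κ') :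
    EntropyLE P Q κ' := fun f hf hC =>
  (Real.exp_le_exp.2 (by linarith)).trans (h f hf hC)

lemma EntropyLE.map {P Q : Measure α} {κ : ℝ} (h : EntropyLE P Q κ) {φ : α → β}
    (hφ : Measurable φ) : EntropyLE (P.map φ) (Q.map φ) κ := by
  rintro f hf ⟨C, hC⟩
  rw [integral_map hφ.aemeasurable hf.aestronglyMeasurable,
    integral_map hφ.aemeasurable hf.exp.aestronglyMeasurable]
  exact h _ (hf.comp hφ) ⟨C, fun x => hC _⟩

/-- Chain rule for the relative entropy. -/
lemma EntropyLE.compProd {P Q : Measure α} [IsProbabilityMeasure P] [IsProbabilityMeasure Q]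
    {K L : Kernel α β} [IsMarkovKernel K] [IsMarkovKernel L] {κ : ℝ} {ρ : α → ℝ}
    (h : EntropyLE P Q κ) (hρ : Integrable ρ P) (hKL : ∀ a, EntropyLE (K a) (L a) (ρ a)) :
    EntropyLE (P ⊗ₘ K) (Q ⊗ₘ L) (κ + ∫ a, ρ a ∂P) := by
  rintro f hf ⟨C, hC⟩
  have hfa (a : α) : Measurable fun b => f (a, b) := hf.comp measurable_prodMk_left
  have hexp : Measurable fun p => Real.exp (f p) := hf.exp
  rw [Measure.integral_compProd (integrable_of_abs_le hf hC),
    Measure.integral_compProd (integrable_exp_of_abs_le hf hC)]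
  set G : α → ℝ := fun a => ∫ b, Real.exp (f (a, b)) ∂(L a) with hG
  have hGm : Measurable G :=
    (StronglyMeasurable.integral_kernel_prod_right' (κ := L) hexp.stronglyMeasurable).measurable
  have hGlow (a : α) : Real.exp (-C) ≤ G a := by
    have := integral_mono (μ := L a) (integrable_const (Real.exp (-C)))
      (integrable_exp_of_abs_le (hfa a) fun b => hC _)
      (fun b => Real.exp_le_exp.2 (neg_le_of_abs_le (hC (a, b))))
    simpa using this
  have hGup (a : α) : G a ≤ Real.exp C := by
    have := integral_mono (μ := L a) (integrable_exp_of_abs_le (hfa a) fun b => hC _)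
      (integrable_const (Real.exp C))
      (fun b => Real.exp_le_exp.2 (le_of_abs_le (hC (a, b))))
    simpa using this
  have hGpos (a : α) : 0 < G a := (Real.exp_pos _).trans_le (hGlow a)
  have hlogC (a : α) : |Real.log (G a)| ≤ C :=
    abs_le.2 ⟨(Real.le_log_iff_exp_le (hGpos a)).2 (hGlow a),
      (Real.log_le_iff_le_exp (hGpos a)).2 (hGup a)⟩
  have hlogm : Measurable fun a => Real.log (G a) := hGm.log
  -- The test function for the first coordinate is the log-Laplace transform of `f (a, ·)` under `L
  -- a`; the bound for `K a` against `L a` says that it dominates the mean of `f (a, ·)` under `K a`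
  -- minus `ρ a`.
  have key := h _ hlogm ⟨C, hlogC⟩
  simp only [Real.exp_log (hGpos _)] at key
  refine le_trans (Real.exp_le_exp.2 ?_) key
  have hI : Integrable (fun a => ∫ b, f (a, b) ∂(K a)) P :=
    integrable_of_abs_le (StronglyMeasurable.integral_kernel_prod_right' (κ := K)
      hf.stronglyMeasurable).measurable (C := C) fun a => by
        have := norm_integral_le_of_norm_le_const (μ := K a) (C := C) (f := fun b => f (a, b))
          (Filter.Eventually.of_forall fun b => hC _)
        simpa using this
  have hle : ∫ a, ((∫ b, f (a, b) ∂(K a)) - ρ a) ∂P ≤ ∫ a, Real.log (G a) ∂P :=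
    integral_mono (hI.sub hρ) (integrable_of_abs_le hlogm hlogC) fun a =>
      (Real.le_log_iff_exp_le (hGpos a)).2 (hKL a _ (hfa a) ⟨C, fun b => hC _⟩)
  rw [integral_sub hI hρ] at hle
  linarith

/-- The likelihood ratio is `exp (t x - t² / 2)`, whose exponent has mean `-t² / 2` under the
standard Gaussian; Jensen's inequality does the rest. -/
lemma EntropyLE.gaussian_shift (t : ℝ) :
    EntropyLE (gaussianReal 0 1) ((gaussianReal 0 1).map (· + t)) (t ^ 2 / 2) := by
  rintro f hf ⟨C, hC⟩
  rw [gaussianReal_map_add_const, zero_add,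
    integral_gaussianReal_eq_integral_smul (μ := t) one_ne_zero]
  have hid : Integrable (fun x : ℝ => x) (gaussianReal 0 1) :=
    (memLp_id_gaussianReal (μ := 0) (v := 1) 1).integrable le_rfl
  have hpdf (x : ℝ) : gaussianPDFReal t 1 x • Real.exp (f x)
      = gaussianPDFReal 0 1 x • Real.exp (f x + (t * x - t ^ 2 / 2)) := by
    simp only [gaussianPDFReal, smul_eq_mul, mul_assoc, ← Real.exp_add]
    congr 2
    simp only [NNReal.coe_one]
    ring
  simp only [hpdf]
  rw [← integral_gaussianReal_eq_integral_smul (μ := 0) one_ne_zero]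
  have hfi : Integrable f (gaussianReal 0 1) := integrable_of_abs_le hf hC
  have hlin : Integrable (fun x : ℝ => t * x - t ^ 2 / 2) (gaussianReal 0 1) :=
    (hid.const_mul t).sub (integrable_const _)
  have hint : ∫ x, (f x + (t * x - t ^ 2 / 2)) ∂(gaussianReal 0 1)
      = ∫ x, f x ∂(gaussianReal 0 1) - t ^ 2 / 2 := by
    rw [integral_add hfi hlin, integral_sub (hid.const_mul t) (integrable_const _),
      integral_const_mul, integral_id_gaussianReal]
    simp
    ring
  rw [← hint]
  refine exp_integral_le_integral_exp (hfi.add hlin) ?_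
  have hexp : Integrable (fun x : ℝ => Real.exp (t * x)) (gaussianReal 0 1) :=
    integrable_exp_mul_gaussianReal t
  refine ((hexp.mul_const (Real.exp (-(t ^ 2 / 2)))).bdd_mul (c := Real.exp C)
    hf.exp.aestronglyMeasurable (Filter.Eventually.of_forall fun x =>
      abs_exp_le_of_abs_le (hC x))).congr (Filter.Eventually.of_forall fun x => ?_)
  simp only [← Real.exp_add]
  ring_nf

/-- An entropy bound for all finite-dimensional marginals passes to events of the trajectory
space. -/
lemma exp_sub_le_of_forall_marginal {X : ℕ → Type*} [∀ n, MeasurableSpace (X n)]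
    {P Q : Measure (∀ n, X n)} [IsProbabilityMeasure P] [IsProbabilityMeasure Q] {κ : ℝ}
    (h : ∀ n, EntropyLE (P.map (Preorder.frestrictLe n)) (Q.map (Preorder.frestrictLe n)) κ)
    {B : Set (∀ n, X n)} (hB : MeasurableSet B) (c : ℝ) :
    Real.exp (c * P.real B - κ) ≤ 1 + (Real.exp c - 1) * Q.real B := by
  have hcyl {t : Set (∀ n, X n)} (ht : t ∈ measurableCylinders X) :
      Real.exp (c * P.real t - κ) ≤ 1 + (Real.exp c - 1) * Q.real t := by
    have htm := MeasurableSet.of_mem_measurableCylinders ht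
    rw [measurableCylinders_nat] at ht
    simp only [Set.mem_iUnion, Set.mem_singleton_iff] at ht
    obtain ⟨n, S, hS, rfl⟩ := ht
    have hφ : Measurable (Preorder.frestrictLe (π := X) n) := by fun_prop
    have key := h n (S.indicator fun _ => c) (measurable_const.indicator hS)
      ⟨|c|, fun x => by by_cases hx : x ∈ S <;> simp [hx]⟩
    have hexp : (fun x => Real.exp (S.indicator (fun _ => c) x))
        = fun x => 1 + S.indicator (fun _ => Real.exp c - 1) x := by
      funext x
      by_cases hx : x ∈ S <;> simp [hx]
    have : IsProbabilityMeasure (Q.map (Preorder.frestrictLe (π := X) n)) :=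
      Measure.isProbabilityMeasure_map hφ.aemeasurable
    rw [hexp, integral_add (integrable_const _) ((integrable_const _).indicator hS),
      integral_indicator_const _ hS, integral_indicator_const _ hS] at key
    simp only [smul_eq_mul, integral_const, probReal_univ, mul_one,
      map_measureReal_apply hφ hS] at key
    change Real.exp (c * P.real (Preorder.frestrictLe n ⁻¹' S) - κ)
      ≤ 1 + (Real.exp c - 1) * Q.real (Preorder.frestrictLe n ⁻¹' S)
    rw [mul_comm c, mul_comm (Real.exp c - 1)]
    exact key
  -- Approximating in `P + Q` makes one sequence of cylinders serve both measures.
  have happrox (k : ℕ) : ∃ t ∈ measurableCylinders X,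
      (P + Q) (symmDiff t B) < ENNReal.ofReal (1 / ((k : ℝ) + 1)) :=
    exists_measure_symmDiff_lt_of_generateFrom_isSetRing isSetRing_measurableCylinders
      ⟨{Set.univ}, Set.countable_singleton _, by simpa using univ_mem_measurableCylinders X,
        by simp⟩ generateFrom_measurableCylinders.symm hB (by simp; positivity)
  choose t ht htlt using happrox
  have htend (R : Measure (∀ n, X n)) [IsProbabilityMeasure R] (hR : R ≤ P + Q) :
      Filter.Tendsto (fun k => R.real (t k)) Filter.atTop (nhds (R.real B)) := by
    rw [tendsto_iff_norm_sub_tendsto_zero]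
    refine squeeze_zero (fun _ => norm_nonneg _) (fun k => ?_)
      tendsto_one_div_add_atTop_nhds_zero_nat
    refine (abs_measureReal_sub_le_measureReal_symmDiff
      (MeasurableSet.of_mem_measurableCylinders (ht k)).nullMeasurableSet
        hB.nullMeasurableSet).trans ?_
    refine ENNReal.toReal_le_of_le_ofReal (by positivity) ?_
    exact (hR _).trans (htlt k).le
  have hP := htend P (Measure.le_add_right le_rfl)
  have hQ := htend Q (Measure.le_add_left le_rfl)
  refine le_of_tendsto_of_tendsto'
    ((Real.continuous_exp.tendsto _).comp ((hP.const_mul c).sub_const κ))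
    ((hQ.const_mul _).const_add 1) fun k => hcyl (ht k)

end Entropy

/-! ### Finite-horizon marginals of trajectory measures -/

/-- The trajectory up to time `n + 1`, as a function of the trajectory up to time `n` and of the
state at time `n + 1`. -/
def snocIic {E : Type*} (n : ℕ) (p : (Finset.Iic n → E) × E) : Finset.Iic (n + 1) → E := fun i =>
  if h : (i : ℕ) ≤ n then p.1 ⟨i, Finset.mem_Iic.2 h⟩ else p.2

lemma measurable_snocIic {E : Type*} [MeasurableSpace E] (n : ℕ) :
    Measurable (snocIic (E := E) n) := by
  refine measurable_pi_lambda _ fun i => ?_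
  by_cases h : (i : ℕ) ≤ n
  · simp only [snocIic, h, dite_true]
    fun_prop
  · simp only [snocIic, h, dite_false]
    fun_prop

lemma snocIic_frestrictLe {E : Type*} (n : ℕ) (h : ℕ → E) :
    snocIic n (Preorder.frestrictLe (π := fun _ => E) n h, h (n + 1))
      = Preorder.frestrictLe (π := fun _ => E) (n + 1) h := by
  funext i
  by_cases hi : (i : ℕ) ≤ n
  · simp [snocIic, hi]
  · have : (i : ℕ) = n + 1 := le_antisymm (Finset.mem_Iic.1 i.2) (by omega)
    simp [snocIic, this]

section Trajectory

variable {E : Type*} [MeasurableSpace E] {μ₀ : Measure E}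
  {κ : (n : ℕ) → Kernel (Finset.Iic n → E) E} [∀ n, IsMarkovKernel (κ n)]

lemma trajMeasure_map_frestrictLe_zero :
    (Kernel.trajMeasure (X := fun _ : ℕ => E) μ₀ κ).map (Preorder.frestrictLe 0)
      = μ₀.map (fun e _ => e) := by
  rw [Kernel.trajMeasure, Measure.map_comp _ _ (by fun_prop), Kernel.traj_map_frestrictLe,
    Kernel.partialTraj_self, Measure.id_comp]
  congr 1

lemma trajMeasure_map_eval_zero :
    (Kernel.trajMeasure (X := fun _ : ℕ => E) μ₀ κ).map (fun h => h 0) = μ₀ := by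
  have h := congrArg (Measure.map fun p : Finset.Iic 0 → E => p ⟨0, by simp⟩)
    (trajMeasure_map_frestrictLe_zero (μ₀ := μ₀) (κ := κ))
  rw [Measure.map_map (by fun_prop) (by fun_prop),
    Measure.map_map (by fun_prop) (by fun_prop)] at h
  exact h.trans Measure.map_id

lemma trajMeasure_map_frestrictLe_succ [IsProbabilityMeasure μ₀] (n : ℕ) :
    (Kernel.trajMeasure (X := fun _ : ℕ => E) μ₀ κ).map (Preorder.frestrictLe (n + 1))
      = (((Kernel.trajMeasure (X := fun _ : ℕ => E) μ₀ κ).map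
          (Preorder.frestrictLe n)) ⊗ₘ κ n).map (snocIic n) := by
  rw [Kernel.map_frestrictLe_trajMeasure_compProd_eq_map_trajMeasure,
    Measure.map_map (measurable_snocIic n) (by fun_prop)]
  congr 1
  funext h
  exact (snocIic_frestrictLe n h).symm

end Trajectory

/-- Keeping the intermediate state, here the action, as an explicit variable lets the chain rule
treat the choice of the action and the observation separately. -/
lemma compProd_comp_eq_map_compProd {α β γ : Type*} [MeasurableSpace α] [MeasurableSpace β]
    [MeasurableSpace γ] (P : Measure α) [SFinite P] (K : Kernel α β) [IsSFiniteKernel K]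
    (L : Kernel β γ) [IsSFiniteKernel L] :
    P ⊗ₘ (L ∘ₖ K) = ((P ⊗ₘ K) ⊗ₘ Kernel.prodMkLeft α L).map (fun p => (p.1.1, p.2)) := by
  ext s hs
  have hm : Measurable fun p : (α × β) × γ => (p.1.1, p.2) := by fun_prop
  rw [Measure.map_apply hm hs, Measure.compProd_apply hs, Measure.compProd_apply (hm hs),
    Measure.lintegral_compProd (Kernel.measurable_kernel_prodMk_left (hm hs))]
  refine lintegral_congr fun a => ?_
  rw [Kernel.comp_apply' _ _ _ (measurable_prodMk_left hs)]
  rfl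

/-! ### Information gained along a strategy -/

variable {n₁ n₂ : ℕ}

/-- The information on the alternative signal `y` against the signal `x` gained by an action. -/
noncomputable def actionInfo (x y : Entry n₁ n₂ → ℝ) (a : Action n₁ n₂) : ℝ :=
  (y a.1 - x a.1) ^ 2 * a.2 / 2

lemma measurable_actionInfo (x y : Entry n₁ n₂ → ℝ) : Measurable (actionInfo x y) := by
  have h : Measurable fun e => (y e - x e) ^ 2 := measurable_of_finite _
  unfold actionInfo
  fun_prop

lemma actionInfo_nonneg (x y : Entry n₁ n₂ → ℝ) (a : Action n₁ n₂) : 0 ≤ actionInfo x y a := by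
  unfold actionInfo
  positivity

lemma observeKernel_apply (x : Entry n₁ n₂ → ℝ) (a : Action n₁ n₂) :
    observeKernel x a = (gaussianReal 0 1).map fun w => observe x (a, w) := by
  rw [observeKernel, Kernel.map_apply _ (measurable_observe x), Kernel.prod_apply,
    Kernel.id_apply, Kernel.const_apply, Measure.dirac_prod,
    Measure.map_map (measurable_observe x) measurable_prodMk_left]
  rfl

lemma entropyLE_observeKernel (x y : Entry n₁ n₂ → ℝ) (a : Action n₁ n₂) :
    EntropyLE (observeKernel x a) (observeKernel y a) (actionInfo x y a) := by
  have hm : Measurable fun w => observe x (a, w) :=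
    (measurable_observe x).comp measurable_prodMk_left
  have h := (EntropyLE.gaussian_shift (Real.sqrt a.2 * (y a.1 - x a.1))).map hm
  rw [Measure.map_map hm (by fun_prop)] at h
  rw [observeKernel_apply, observeKernel_apply]
  convert h using 1
  -- Shifting the noise by `√Γ (y - x)` turns an observation of `x` into one of `y`; for `Γ = 0`
  -- both observations are the constant `0`.
  · congr 1
    funext w
    by_cases ha : a.2 = 0
    · simp [observe, ha]
    · have : Real.sqrt a.2 ≠ 0 := by
        rw [Real.sqrt_ne_zero']
        exact_mod_cast pos_iff_ne_zero.2 ha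
      simp only [observe, ha, if_false, Function.comp_apply]
      congr 1
      field_simp
      ring
  · rw [actionInfo, mul_pow, Real.sq_sqrt (NNReal.coe_nonneg _)]
    ring

lemma map_fst_observeKernel_comp {P : Measure (Action n₁ n₂)} [IsProbabilityMeasure P]
    (x : Entry n₁ n₂ → ℝ) : (observeKernel x ∘ₘ P).map Prod.fst = P := by
  rw [Measure.map_comp _ _ measurable_fst]
  have : (observeKernel x).map Prod.fst = Kernel.id := by
    ext1 a
    have hm : Measurable fun w => observe x (a, w) :=
      (measurable_observe x).comp measurable_prodMk_left
    rw [Kernel.map_apply _ measurable_fst, observeKernel_apply, Measure.map_map measurable_fst hm,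
      Kernel.id_apply]
    change Measure.map (fun _ => a) _ = _
    rw [Measure.map_const]
    simp
  rw [this, Measure.id_comp]

namespace Strategy

variable (σ : Strategy n₁ n₂) (x y : Entry n₁ n₂ → ℝ)

lemma measurable_action (j : ℕ) : Measurable fun h : Data n₁ n₂ => (h j).1 := by fun_prop

lemma entropyLE_marginal
    (hint : ∀ j, Integrable (fun h : Data n₁ n₂ => actionInfo x y (h j).1) (σ.dataLaw x)) (n : ℕ) :
    EntropyLE ((σ.dataLaw x).map (Preorder.frestrictLe n))
      ((σ.dataLaw y).map (Preorder.frestrictLe n))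
      (∑ j ∈ Finset.range (n + 1), ∫ h, actionInfo x y (h j).1 ∂(σ.dataLaw x)) := by
  induction n with
  | zero =>
    have hfst : (σ.dataLaw x).map (fun h => (h 0).1) = σ.first := by
      have h := congrArg (Measure.map Prod.fst) (trajMeasure_map_eval_zero
        (μ₀ := observeKernel x ∘ₘ σ.first) (κ := fun j => observeKernel x ∘ₖ σ.next j))
      rw [map_fst_observeKernel_comp, Measure.map_map (by fun_prop) (by fun_prop)] at h
      exact h
    have hI : Integrable (actionInfo x y) σ.first := by
      rw [← hfst]
      exact (integrable_map_measure (measurable_actionInfo x y).aestronglyMeasurable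
        (measurable_action 0).aemeasurable).2 (hint 0)
    have h := ((EntropyLE.refl σ.first).compProd hI (entropyLE_observeKernel x y)).map
      measurable_snd
    have hval : ∫ a, actionInfo x y a ∂σ.first
        = ∫ h, actionInfo x y (h 0).1 ∂(σ.dataLaw x) := by
      rw [← hfst, integral_map (measurable_action 0).aemeasurable (measurable_actionInfo x y).aestronglyMeasurable]
    rw [hval, zero_add, ← Measure.snd, ← Measure.snd, Measure.snd_compProd,
      Measure.snd_compProd] at h
    have hm : Measurable fun (e : Record n₁ n₂) (_ : Finset.Iic 0) => e := by fun_prop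
    have h' := h.map hm
    rw [← trajMeasure_map_frestrictLe_zero (κ := fun j => observeKernel x ∘ₖ σ.next j),
      ← trajMeasure_map_frestrictLe_zero (κ := fun j => observeKernel y ∘ₖ σ.next j)] at h'
    rw [zero_add, Finset.sum_range_one]
    exact h'
  | succ n ih =>
    have hprob (z : Entry n₁ n₂ → ℝ) :
        IsProbabilityMeasure ((σ.dataLaw z).map (Preorder.frestrictLe n)) :=
      Measure.isProbabilityMeasure_map (by fun_prop)
    have := hprob x
    have := hprob y
    -- The next action has the same conditional law under both signals, hence entropy cost zero.
    have hmid := ih.compProd (ρ := fun _ => 0) (integrable_zero _ _ _)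
      (fun a => EntropyLE.refl (σ.next n a))
    have hpath (z : Entry n₁ n₂ → ℝ) :
        ((σ.dataLaw z).map (Preorder.frestrictLe n)) ⊗ₘ (observeKernel z ∘ₖ σ.next n)
          = ((((σ.dataLaw z).map (Preorder.frestrictLe n)) ⊗ₘ σ.next n)
              ⊗ₘ Kernel.prodMkLeft _ (observeKernel z)).map (fun p => (p.1.1, p.2)) :=
      compProd_comp_eq_map_compProd _ _ _
    have hact : (((σ.dataLaw x).map (Preorder.frestrictLe n)) ⊗ₘ σ.next n).map Prod.snd
        = (σ.dataLaw x).map (fun h => (h (n + 1)).1) := by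
      have h := congrArg (Measure.map Prod.snd)
        (Kernel.map_frestrictLe_trajMeasure_compProd_eq_map_trajMeasure (X := fun _ => Record n₁ n₂)
          (μ₀ := observeKernel x ∘ₘ σ.first) (κ := fun j => observeKernel x ∘ₖ σ.next j) (a := n))
      rw [← Measure.snd, Measure.snd_compProd, ← Measure.comp_assoc,
        Measure.map_map (by fun_prop) (by fun_prop)] at h
      have h' := congrArg (Measure.map Prod.fst) h
      have : IsProbabilityMeasure ((Kernel.trajMeasure (X := fun _ => Record n₁ n₂)
          (observeKernel x ∘ₘ σ.first) fun j => observeKernel x ∘ₖ σ.next j).map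
            (Preorder.frestrictLe n)) := hprob x
      rw [map_fst_observeKernel_comp, Measure.map_map (by fun_prop) (by fun_prop)] at h'
      rw [← Measure.snd, Measure.snd_compProd]
      exact h'
    have hI : Integrable (fun p => actionInfo x y p.2)
        (((σ.dataLaw x).map (Preorder.frestrictLe n)) ⊗ₘ σ.next n) := by
      have h1 : Integrable (actionInfo x y)
          ((((σ.dataLaw x).map (Preorder.frestrictLe n)) ⊗ₘ σ.next n).map Prod.snd) := by
        rw [hact]
        exact (integrable_map_measure (measurable_actionInfo x y).aestronglyMeasurable
          (measurable_action (n + 1)).aemeasurable).2 (hint (n + 1))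
      exact (integrable_map_measure (measurable_actionInfo x y).aestronglyMeasurable
        (by fun_prop)).1 h1
    have hval : ∫ p, actionInfo x y p.2 ∂(((σ.dataLaw x).map (Preorder.frestrictLe n)) ⊗ₘ σ.next n)
        = ∫ h, actionInfo x y (h (n + 1)).1 ∂(σ.dataLaw x) := by
      rw [← integral_map (f := actionInfo x y) (by fun_prop)
        (measurable_actionInfo x y).aestronglyMeasurable, hact,
        integral_map (measurable_action (n + 1)).aemeasurable (measurable_actionInfo x y).aestronglyMeasurable]
    have h := ((hmid.compProd (K := Kernel.prodMkLeft _ (observeKernel x))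
      (L := Kernel.prodMkLeft _ (observeKernel y)) hI
      (fun p => entropyLE_observeKernel x y p.2)).map
        (φ := fun p => (p.1.1, p.2)) (by fun_prop)).map (measurable_snocIic n)
    rw [← hpath, ← hpath, hval, integral_zero, add_zero, ← Finset.sum_range_succ] at h
    rw [dataLaw, dataLaw, trajMeasure_map_frestrictLe_succ, trajMeasure_map_frestrictLe_succ]
    exact h

end Strategy

/-! ### Sharing the budget among disjoint supports, and change of measure -/

lemma signal_empty (μ : ℝ) (i : Entry n₁ n₂) : signal μ ∅ i = 0 := by simp [signal]

lemma actionInfo_signal (μ : ℝ) (S : Finset (Entry n₁ n₂)) (a : Action n₁ n₂) :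
    actionInfo (signal μ ∅) (signal μ S) a = if a.1 ∈ S then μ ^ 2 / 2 * a.2 else 0 := by
  rw [actionInfo, signal_empty, signal]
  split_ifs <;> ring

lemma sum_actionInfo_signal_le (μ : ℝ) {D : Finset (Finset (Entry n₁ n₂))}
    (hD : (D : Set (Finset (Entry n₁ n₂))).PairwiseDisjoint id) (a : Action n₁ n₂) :
    ∑ S ∈ D, actionInfo (signal μ ∅) (signal μ S) a ≤ μ ^ 2 / 2 * a.2 := by
  simp only [actionInfo_signal]
  rw [← Finset.sum_filter, Finset.sum_const, nsmul_eq_mul]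
  have hcard : (D.filter fun S => a.1 ∈ S).card ≤ 1 := by
    refine Finset.card_le_one.2 fun S hS T hT => ?_
    rw [Finset.mem_filter] at hS hT
    by_contra hne
    exact Finset.disjoint_left.1 (hD hS.1 hT.1 hne) hS.2 hT.2
  have hcard' : ((D.filter fun S => a.1 ∈ S).card : ℝ) ≤ 1 := by exact_mod_cast hcard
  exact mul_le_of_le_one_left (by positivity) hcard'

/-- The expected information on the alternative signal `y` against the signal `x` gained by the
whole procedure, when the signal is `x`. -/
noncomputable def Strategy.totalInfo (σ : Strategy n₁ n₂) (x y : Entry n₁ n₂ → ℝ) : ℝ≥0∞ :=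
  ∫⁻ h, ∑' j, ENNReal.ofReal (actionInfo x y (h j).1) ∂(σ.dataLaw x)

lemma measurable_ofReal_actionInfo (x y : Entry n₁ n₂ → ℝ) (j : ℕ) :
    Measurable fun h : Data n₁ n₂ => ENNReal.ofReal (actionInfo x y (h j).1) :=
  ((measurable_actionInfo x y).comp (Strategy.measurable_action j)).ennreal_ofReal

lemma Strategy.sum_totalInfo_le (σ : Strategy n₁ n₂) (μ : ℝ) {D : Finset (Finset (Entry n₁ n₂))}
    (hD : (D : Set (Finset (Entry n₁ n₂))).PairwiseDisjoint id) :
    ∑ S ∈ D, σ.totalInfo (signal μ ∅) (signal μ S)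
      ≤ ENNReal.ofReal (μ ^ 2 / 2) * ∫⁻ h, totalPrecision h ∂(σ.dataLaw (signal μ ∅)) := by
  have hm (S : Finset (Entry n₁ n₂)) (j : ℕ) :=
    measurable_ofReal_actionInfo (signal μ ∅) (signal μ S) j
  simp only [totalInfo]
  rw [← lintegral_finsetSum _ fun S _ => Measurable.tsum (hm S),
    ← lintegral_const_mul' _ _ ENNReal.ofReal_ne_top]
  refine lintegral_mono fun h => ?_
  rw [totalPrecision, ← ENNReal.tsum_mul_left, ← Summable.tsum_finsetSum fun _ _ => ENNReal.summable]
  refine ENNReal.tsum_le_tsum fun j => ?_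
  rw [← ENNReal.ofReal_sum_of_nonneg fun _ _ => actionInfo_nonneg _ _ _,
    ← ENNReal.ofReal_coe_nnreal, ← ENNReal.ofReal_mul (by positivity)]
  exact ENNReal.ofReal_le_ofReal (sum_actionInfo_signal_le μ hD _)

/-- Change of measure: an event is not much less likely under `y` than under `x`. -/
lemma Strategy.exp_sub_totalInfo_le (σ : Strategy n₁ n₂) (x y : Entry n₁ n₂ → ℝ)
    (hfin : σ.totalInfo x y ≠ ∞) {B : Set (Data n₁ n₂)} (hB : MeasurableSet B) (c : ℝ) :
    Real.exp (c * (σ.dataLaw x).real B - (σ.totalInfo x y).toReal)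
      ≤ 1 + (Real.exp c - 1) * (σ.dataLaw y).real B := by
  have hm := measurable_ofReal_actionInfo x y
  have htsum : σ.totalInfo x y
      = ∑' j, ∫⁻ h, ENNReal.ofReal (actionInfo x y (h j).1) ∂(σ.dataLaw x) :=
    lintegral_tsum fun j => (hm j).aemeasurable
  have hmr (j : ℕ) : Measurable fun h : Data n₁ n₂ => actionInfo x y (h j).1 :=
    (measurable_actionInfo x y).comp (measurable_action j)
  have hj (j : ℕ) : ∫⁻ h, ENNReal.ofReal (actionInfo x y (h j).1) ∂(σ.dataLaw x) ≠ ∞ :=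
    ne_top_of_le_ne_top hfin (htsum ▸ ENNReal.le_tsum j)
  have hint (j : ℕ) : Integrable (fun h : Data n₁ n₂ => actionInfo x y (h j).1) (σ.dataLaw x) :=
    (lintegral_ofReal_ne_top_iff_integrable (hmr j).aestronglyMeasurable
      (Filter.Eventually.of_forall fun _ => actionInfo_nonneg _ _ _)).1 (hj j)
  refine exp_sub_le_of_forall_marginal (X := fun _ => Record n₁ n₂)
    (fun n => (σ.entropyLE_marginal x y hint n).mono ?_) hB c
  have hval (j : ℕ) : ∫ h, actionInfo x y (h j).1 ∂(σ.dataLaw x)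
      = (∫⁻ h, ENNReal.ofReal (actionInfo x y (h j).1) ∂(σ.dataLaw x)).toReal :=
    integral_eq_lintegral_of_nonneg_ae
      (Filter.Eventually.of_forall fun _ => actionInfo_nonneg _ _ _) (hmr j).aestronglyMeasurable
  simp only [hval]
  rw [← ENNReal.toReal_sum fun j _ => hj j]
  exact ENNReal.toReal_mono hfin (htsum ▸ ENNReal.sum_le_tsum _)

/-! ### Lower bound for detection -/

/-- After writing the left side as `log (2 / δ) - log 4`, both `log (3 - δ)` and `log (2 / δ)` are
bounded by the tangent line of the logarithm at `4`. What remains is `log 4 ≤ 3 / 2`. -/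
lemma log_le_mul_log_sub_log {δ p : ℝ} (hδ : 0 < δ) (hδ' : δ ≤ 1 / 2) (hp : p ≤ δ / 2) :
    Real.log (1 / (2 * δ)) ≤ Real.log (2 / δ) * (1 - p) - Real.log (3 - δ) := by
  have hlog : 0 ≤ Real.log (2 / δ) := Real.log_nonneg (by rw [le_div_iff₀ hδ]; linarith)
  have h1 : Real.log (1 / (2 * δ)) = Real.log (2 / δ) - Real.log 4 := by
    rw [← Real.log_div (by positivity) (by norm_num)]
    congr 1
    field_simp
    norm_num
  have h4 : Real.log 4 ≤ 3 / 2 := by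
    have : (4 : ℝ) = 2 ^ 2 := by norm_num
    rw [this, Real.log_pow]
    have := Real.log_two_lt_d9
    push_cast
    linarith
  have h2 : Real.log (3 - δ) ≤ Real.log 4 + ((3 - δ) / 4 - 1) := by
    have := Real.log_le_sub_one_of_pos (x := (3 - δ) / 4) (by linarith)
    rw [Real.log_div (by linarith) (by norm_num)] at this
    linarith
  have h3 : δ / 2 * Real.log (2 / δ) ≤ 1 / 4 - δ / 2 + δ / 2 * Real.log 4 := by
    have := Real.log_le_sub_one_of_pos (x := 2 / δ / 4) (by positivity)
    rw [Real.log_div (by positivity) (by norm_num)] at this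
    have := mul_le_mul_of_nonneg_left this (by positivity : 0 ≤ δ / 2)
    have e : δ / 2 * (2 / δ / 4 - 1) = 1 / 4 - δ / 2 := by field_simp
    linarith
  have h5 : p * Real.log (2 / δ) ≤ δ / 2 * Real.log (2 / δ) := mul_le_mul_of_nonneg_right hp hlog
  nlinarith

/-- The lower bound for the detection of one among at least two disjoint supports. -/
lemma Strategy.card_mul_log_le (σ : Strategy n₁ n₂) {μ m δ : ℝ} (hm : 0 < m) (hδ : 0 < δ)
    (hδ' : δ ≤ 1 / 2) {D : Finset (Finset (Entry n₁ n₂))}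
    (hD : (D : Set (Finset (Entry n₁ n₂))).PairwiseDisjoint id) (hcard : 2 ≤ D.card)
    (hbudget : ∫⁻ h, totalPrecision h ∂(σ.dataLaw (signal μ ∅)) ≤ ENNReal.ofReal m)
    {A : Finset (Entry n₁ n₂) → Set (Data n₁ n₂)} (hA : ∀ S ∈ D, MeasurableSet (A S))
    (h0 : ∑ S ∈ D, (σ.dataLaw (signal μ ∅)).real (A S) ≤ δ)
    (h1 : ∀ S ∈ D, (σ.dataLaw (signal μ S)).real (A S)ᶜ ≤ δ) :
    D.card * Real.log (1 / (2 * δ)) ≤ μ ^ 2 * m / 2 := by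
  have hsum : ∑ S ∈ D, σ.totalInfo (signal μ ∅) (signal μ S) ≤ ENNReal.ofReal (μ ^ 2 * m / 2) := by
    refine (σ.sum_totalInfo_le μ hD).trans ?_
    rw [show μ ^ 2 * m / 2 = μ ^ 2 / 2 * m by ring, ENNReal.ofReal_mul (by positivity)]
    gcongr
  have hfin {S} (hS : S ∈ D) : σ.totalInfo (signal μ ∅) (signal μ S) ≠ ∞ :=
    ENNReal.sum_ne_top.1 (ne_top_of_le_ne_top ENNReal.ofReal_ne_top hsum) S hS
  have hsum' : ∑ S ∈ D, (σ.totalInfo (signal μ ∅) (signal μ S)).toReal ≤ μ ^ 2 * m / 2 := by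
    rw [← ENNReal.toReal_sum fun S hS => hfin hS]
    exact ENNReal.toReal_le_of_le_ofReal (by positivity) hsum
  have hone {S} (hS : S ∈ D) :
      Real.log (2 / δ) * (1 - (σ.dataLaw (signal μ ∅)).real (A S)) - Real.log (3 - δ)
        ≤ (σ.totalInfo (signal μ ∅) (signal μ S)).toReal := by
    -- The complement of `A S` is likely under the null and rare under `S`. With `exp c = 2 / δ`,
    -- the right side is at most `1 + (2 / δ - 1) δ = 3 - δ`.
    have h := σ.exp_sub_totalInfo_le _ _ (hfin hS) (hA S hS).compl (Real.log (2 / δ))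
    rw [Real.exp_log (by positivity), probReal_compl_eq_one_sub (μ := σ.dataLaw (signal μ ∅))
      (hA S hS)] at h
    have h2 : (0 : ℝ) ≤ 2 / δ - 1 := by
      rw [sub_nonneg, le_div_iff₀ hδ]
      linarith
    have h3 := mul_le_mul_of_nonneg_left (h1 S hS) h2
    have h4 : (2 / δ - 1) * δ = 2 - δ := by field_simp
    have h5 := (Real.le_log_iff_exp_le (by linarith)).2
      (h.trans (by linarith : _ ≤ 3 - δ))
    linarith
  have hN : (2 : ℝ) ≤ D.card := by exact_mod_cast hcard
  set p : ℝ := (∑ S ∈ D, (σ.dataLaw (signal μ ∅)).real (A S)) / D.card with hp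
  -- Having at least two tiles is what brings the average null probability down to `δ / 2`.
  have hpδ : p ≤ δ / 2 := by
    rw [hp, div_le_div_iff₀ (by linarith) two_pos]
    nlinarith
  have hpN : D.card * p = ∑ S ∈ D, (σ.dataLaw (signal μ ∅)).real (A S) := by
    rw [hp]
    field_simp
  have havg := (Finset.sum_le_sum fun S hS => hone hS).trans hsum'
  rw [Finset.sum_sub_distrib, ← Finset.mul_sum, Finset.sum_sub_distrib, ← hpN] at havg
  simp only [Finset.sum_const, nsmul_eq_mul, mul_one] at havg
  have := mul_le_mul_of_nonneg_left (log_le_mul_log_sub_log hδ hδ' hpδ)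
    (by linarith : (0 : ℝ) ≤ D.card)
  nlinarith

/-! ### Counting with tilings -/

lemma card_of_mem_submatrices {s : ℕ} {S : Finset (Entry n₁ n₂)} (hS : S ∈ submatrices n₁ n₂ s) :
    S.card = s := by
  obtain ⟨S₁, S₂, h, rfl⟩ := hS
  rw [Finset.card_product, h]

lemma TiledBySubmatrices.exists_finset {s : ℕ} (h : TiledBySubmatrices n₁ n₂ s) :
    ∃ D : Finset (Finset (Entry n₁ n₂)), (∀ S ∈ D, S ∈ submatrices n₁ n₂ s) ∧
      (D : Set (Finset (Entry n₁ n₂))).PairwiseDisjoint id ∧ D.card * s = n₁ * n₂ := by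
  obtain ⟨D, hDs, hdisj, hcov⟩ := h
  have hfin : D.Finite := Set.toFinite D
  refine ⟨hfin.toFinset, fun S hS => hDs (by simpa using hS), by simpa using hdisj, ?_⟩
  have hU : hfin.toFinset.biUnion id = Finset.univ := by
    ext i
    simpa using hcov i
  have hc : (hfin.toFinset.biUnion id).card = ∑ S ∈ hfin.toFinset, S.card :=
    Finset.card_biUnion fun S hS T hT hne =>
      hdisj (by simpa using hS) (by simpa using hT) hne
  rw [hU, Finset.card_univ, Finset.sum_congr rfl fun S hS =>
    card_of_mem_submatrices (hDs ((Set.Finite.mem_toFinset hfin).1 hS))] at hc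
  simpa using hc.symm

/-- Disjoint sets meet a finite set in at most as many points as it has. -/
lemma sum_card_inter_le {α : Type*} [DecidableEq α] {D : Finset (Finset α)}
    (hD : (D : Set (Finset α)).PairwiseDisjoint id) (T : Finset α) :
    ∑ S ∈ D, (T ∩ S).card ≤ T.card := by
  rw [← Finset.card_biUnion (t := fun S => T ∩ S) fun S hS U hU hne =>
    (hD hS hU hne).mono Finset.inter_subset_right Finset.inter_subset_right]
  exact Finset.card_le_card (Finset.biUnion_subset.2 fun S _ => Finset.inter_subset_left)

lemma sum_measureReal_eq_le {Ω α : Type*} [MeasurableSpace Ω] {P : Measure Ω}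
    [IsProbabilityMeasure P] {D : Finset α} {f : Ω → α} (hf : ∀ S, MeasurableSet {h | f h = S})
    {B : Set Ω} (hB : ∀ h, f h ∈ D → h ∈ B) :
    ∑ S ∈ D, P.real {h | f h = S} ≤ P.real B := by
  rw [← measureReal_biUnion_finset (fun S _ T _ hne => Set.disjoint_left.2 fun h hS hT =>
    hne (hS.symm.trans hT)) fun S _ => hf S]
  refine measureReal_mono fun h hh => ?_
  simp only [Set.mem_iUnion, Set.mem_ofPred_eq, exists_prop, exists_eq_right'] at hh
  exact hB h hh

end AdaptiveSensing

/-! ### The two recovery bounds -/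

open AdaptiveSensing in
theorem proposition20 (n₁ n₂ s : ℕ) (hsn : s < n₁ * n₂)
    (htile : AdaptiveSensing.TiledBySubmatrices n₁ n₂ s)
    (μ m ε : ℝ) (hμ : 0 < μ) (hm : 0 < m) (hε₀ : 0 < ε) (hε₁ : ε < 1)
    (σ : AdaptiveSensing.Strategy n₁ n₂)
    (hbudget : ∀ S ∈ AdaptiveSensing.submatrices n₁ n₂ s ∪ {∅},
      ∫⁻ h, AdaptiveSensing.totalPrecision h ∂(σ.dataLaw (AdaptiveSensing.signal μ S))
        ≤ ENNReal.ofReal m)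
    (Shat : AdaptiveSensing.Data n₁ n₂ → Finset (AdaptiveSensing.Entry n₁ n₂))
    (hShat : Measurable Shat) :
    ((∀ S ∈ AdaptiveSensing.submatrices n₁ n₂ s ∪ {∅},
        (σ.dataLaw (AdaptiveSensing.signal μ S)).real {h | Shat h ≠ S} ≤ ε) →
      Real.sqrt (2 * ((n₁ * n₂ : ℕ) : ℝ) / ((s : ℝ) * m) * Real.log (1 / (2 * ε))) ≤ μ) ∧
    ((∀ S ∈ AdaptiveSensing.submatrices n₁ n₂ s ∪ {∅},
        ∫ h, ((symmDiff (Shat h) S).card : ℝ) ∂(σ.dataLaw (AdaptiveSensing.signal μ S)) ≤ ε) →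
      Real.sqrt (2 * (((n₁ * n₂ : ℕ) : ℝ) - (s : ℝ)) / ((s : ℝ) * m) *
        (Real.log ((((n₁ * n₂ : ℕ) : ℝ) - (s : ℝ)) / (((n₁ * n₂ : ℕ) : ℝ) + (s : ℝ))) +
          Real.log ((s : ℝ) / (8 * ε)))) ≤ μ) := by
  obtain ⟨D, hDs, hdisj, hcard⟩ := htile.exists_finset
  have hs : 0 < s := Nat.pos_of_ne_zero fun h => by subst h; omega
  have hN : 2 ≤ D.card := by
    by_contra hlt
    have : D.card ≤ 1 := by omega
    have := Nat.mul_le_mul_right s this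
    omega
  have hcardR : (D.card : ℝ) * s = ((n₁ * n₂ : ℕ) : ℝ) := by exact_mod_cast hcard
  have hsR : (0 : ℝ) < s := by exact_mod_cast hs
  have hNR : (2 : ℝ) ≤ D.card := by exact_mod_cast hN
  have hpre (V : Set (Finset (Entry n₁ n₂))) : MeasurableSet (Shat ⁻¹' V) :=
    hShat V.toFinite.measurableSet
  have h0mem : (∅ : Finset (Entry n₁ n₂)) ∈ submatrices n₁ n₂ s ∪ {∅} := Or.inr rfl
  rw [← hcardR]
  constructor
  · intro hrisk
    refine Real.sqrt_le_iff.2 ⟨hμ.le, ?_⟩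
    rcases le_or_gt ε (1 / 2) with hε | hε
    · have key := σ.card_mul_log_le (μ := μ) (A := fun S => {h | Shat h = S}) hm hε₀ hε hdisj hN
        (hbudget ∅ h0mem) (fun S _ => hpre {S})
        ((sum_measureReal_eq_le (B := {h | Shat h ≠ ∅}) (fun S => hpre {S})
          fun h hh (he : Shat h = ∅) => by
            have := card_of_mem_submatrices (hDs _ hh)
            rw [he, Finset.card_empty] at this
            omega).trans (hrisk ∅ h0mem))
        (fun S hS => hrisk S (Or.inl (hDs S hS)))
      have e : 2 * ((D.card : ℝ) * s) / (s * m) * Real.log (1 / (2 * ε))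
          = 2 / m * (D.card * Real.log (1 / (2 * ε))) := by field_simp
      rw [e, div_mul_eq_mul_div, div_le_iff₀ hm]
      linarith
    · refine (mul_nonpos_of_nonneg_of_nonpos (by positivity) ?_).trans (sq_nonneg μ)
      refine Real.log_nonpos (by positivity) ?_
      rw [div_le_one (by positivity)]
      linarith
  · intro hrisk
    refine Real.sqrt_le_iff.2 ⟨hμ.le, ?_⟩
    have hns : (0 : ℝ) < D.card * s - s := by nlinarith
    -- With `δ = 2ε / s` one has `1 / (2δ) = s / (4ε)`, twice the argument `s / (8ε)` in the claim,
    -- while the factor `(n - s) / (n + s)` is at most `1`: the detection bound is stronger than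
    -- needed.
    have hlog : Real.log ((D.card * s - s) / (D.card * s + s)) + Real.log (s / (8 * ε))
        ≤ Real.log (1 / (2 * (2 * ε / s))) := by
      rw [← Real.log_mul (by positivity) (by positivity)]
      refine Real.log_le_log (by positivity) ?_
      have e : 1 / (2 * (2 * ε / s)) = 2 * (s / (8 * ε)) := by
        field_simp
        norm_num
      rw [e]
      refine mul_le_mul_of_nonneg_right ?_ (by positivity)
      rw [div_le_iff₀ (by positivity)]
      nlinarith
    refine (mul_le_mul_of_nonneg_left hlog (by positivity)).trans ?_
    rcases le_or_gt (2 * ε / s) (1 / 2) with hε | hε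
    · have hmarkov (S T : Finset (Entry n₁ n₂)) :
          Integrable (fun h => ((symmDiff (Shat h) T).card : ℝ)) (σ.dataLaw (signal μ S)) :=
        integrable_of_abs_le (C := n₁ * n₂)
          ((measurable_of_finite fun V : Finset (Entry n₁ n₂) =>
            ((symmDiff V T).card : ℝ)).comp hShat) fun h => by
          rw [abs_of_nonneg (Nat.cast_nonneg _)]
          have := Finset.card_le_univ (symmDiff (Shat h) T)
          simp only [Fintype.card_prod, Fintype.card_fin] at this
          exact_mod_cast this
      have key := σ.card_mul_log_le (μ := μ) (A := fun S => {h | s ≤ 2 * (Shat h ∩ S).card}) hm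
        (by positivity) hε hdisj hN (hbudget ∅ h0mem)
        (fun S _ => hpre {V | s ≤ 2 * (V ∩ S).card}) ?_ ?_
      · have hl : 0 ≤ Real.log (1 / (2 * (2 * ε / s))) := by
          refine Real.log_nonneg ?_
          rw [le_div_iff₀ (by positivity)]
          linarith
        have e : 2 * ((D.card : ℝ) * s - s) / (s * m) * Real.log (1 / (2 * (2 * ε / s)))
            = 2 / m * ((D.card - 1) * Real.log (1 / (2 * (2 * ε / s)))) := by field_simp
        rw [e, div_mul_eq_mul_div, div_le_iff₀ hm]
        nlinarith
      -- Markov's inequality is applied pointwise, before summing: the tiles are disjoint, so the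
      -- overlaps add up to at most the size of the estimator, which under the null is its Hamming
      -- loss. Bounding each tile separately would lose a factor `N`.
      · have hind (S : Finset (Entry n₁ n₂)) (h : Data n₁ n₂) :
            {h | s ≤ 2 * (Shat h ∩ S).card}.indicator (fun _ => (1 : ℝ)) h
              ≤ 2 / s * (Shat h ∩ S).card := by
          by_cases hh : s ≤ 2 * (Shat h ∩ S).card
          · have : (s : ℝ) ≤ 2 * (Shat h ∩ S).card := by exact_mod_cast hh
            rw [Set.indicator_of_mem (by exact hh), div_mul_eq_mul_div, le_div_iff₀ hsR]
            linarith
          · rw [Set.indicator_of_notMem (by exact hh)]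
            positivity
        have hmeas (S : Finset (Entry n₁ n₂)) :
            MeasurableSet {h | s ≤ 2 * (Shat h ∩ S).card} := hpre {V | s ≤ 2 * (V ∩ S).card}
        have hii (S : Finset (Entry n₁ n₂)) : Integrable
            ({h | s ≤ 2 * (Shat h ∩ S).card}.indicator fun _ => (1 : ℝ))
            (σ.dataLaw (signal μ ∅)) := (integrable_const _).indicator (hmeas S)
        have hexp : ∑ S ∈ D, (σ.dataLaw (signal μ ∅)).real {h | s ≤ 2 * (Shat h ∩ S).card}
            = ∫ h, ∑ S ∈ D, {h | s ≤ 2 * (Shat h ∩ S).card}.indicator (fun _ => (1 : ℝ)) h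
                ∂(σ.dataLaw (signal μ ∅)) := by
          rw [integral_finsetSum _ fun S _ => hii S]
          exact Finset.sum_congr rfl fun S _ => (integral_indicator_one (hmeas S)).symm
        rw [hexp]
        calc _ ≤ ∫ h, 2 / s * ((symmDiff (Shat h) ∅).card : ℝ) ∂(σ.dataLaw (signal μ ∅)) := by
              refine integral_mono (integrable_finsetSum _ fun S _ => hii S)
                ((hmarkov ∅ ∅).const_mul _) fun h => ?_
              refine (Finset.sum_le_sum fun S _ => hind S h).trans ?_
              rw [← Finset.mul_sum, ← Nat.cast_sum]
              refine mul_le_mul_of_nonneg_left ?_ (by positivity)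
              rw [← Finset.bot_eq_empty, symmDiff_bot]
              exact_mod_cast sum_card_inter_le hdisj (Shat h)
          _ ≤ 2 / s * ε := by
              rw [integral_const_mul]
              exact mul_le_mul_of_nonneg_left (hrisk ∅ h0mem) (by positivity)
          _ = _ := by ring
      · intro S hS
        have hSrisk := hrisk S (Or.inl (hDs S hS))
        have hmk := mul_meas_ge_le_integral_of_nonneg
          (Filter.Eventually.of_forall fun h => Nat.cast_nonneg _) (hmarkov S S) ((s : ℝ) / 2)
        -- Covering less than half of `S` means missing more than `s / 2` of its entries.
        have hsub : {h | s ≤ 2 * (Shat h ∩ S).card}ᶜ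
            ⊆ {h | (s : ℝ) / 2 ≤ ((symmDiff (Shat h) S).card : ℝ)} := by
          intro h hh
          simp only [Set.mem_compl_iff, Set.mem_ofPred_eq, not_le] at hh ⊢
          have h1 : (S \ Shat h).card + (Shat h ∩ S).card = S.card := by
            rw [Finset.inter_comm]
            exact Finset.card_sdiff_add_card_inter S (Shat h)
          have h2 : (S \ Shat h).card ≤ (symmDiff (Shat h) S).card :=
            Finset.card_le_card (le_sup_right (a := Shat h \ S))
          rw [card_of_mem_submatrices (hDs S hS)] at h1
          rw [div_le_iff₀ two_pos]
          exact_mod_cast (by omega : s ≤ (symmDiff (Shat h) S).card * 2)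
        have hmono := measureReal_mono (μ := σ.dataLaw (signal μ S)) hsub
        rw [le_div_iff₀ hsR]
        nlinarith
    -- For `δ > 1 / 2` the logarithm is nonpositive and the bound is void.
    · refine (mul_nonpos_of_nonneg_of_nonpos (by positivity) ?_).trans (sq_nonneg μ)
      refine Real.log_nonpos (by positivity) ?_
      rw [div_le_one (by positivity)]
      linarith
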